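/- Conventions. Algebras are associative, unital, over $\mathbb C$. For a locally convex space $X$ let $X^\star$ be the space of continuous linear functionals with the topology of uniform convergence on totally bounded sets; $X$ is *stereotype* if the canonical map $X\to X^{\star\star}$ is an isomorphism of topological vector spaces. An *involutive stereotype algebra* is a stereotype space $A$ with a continuous involution making it a $*$-algebra, whose multiplication is such that for every totally bounded $S\subseteq A$ and every neighbourhood of zero $U$ there is a neighbourhood of zero $V$ with $S\cdot V\subseteq U$ and $V\cdot S\subseteq U$. Its *involutive spectrum* $\operatorname{Spec}(A)$ is the set of continuous unital $*$-homomorphisms $t:A\to\mathbb C$ with the topology of uniform convergence on totally bounded subsets of $A$; put $I_t=\operatorname{Ker}t$. Let $A$ be a commutative involutive stereotype algebra, $B$ a (unital) $C^*$-algebra, and $\varphi:A\to B$ a continuous unital $*$-homomorphism with $\varphi(A)\subseteq Z(B)$. For $t\in\operatorname{Spec}(A)$ let $\overline{I_t\cdot B}$ be the closure of the set of finite sums $\sum_i\varphi(a_i)b_i$ with $a_i\in I_t$, $b_i\in B$ (a closed two-sided $*$-ideal). The *value bundle* is the disjoint union $$J^0_AB=\bigsqcup_{t\in\operatorname{Spec}(A)}B/\overline{I_t\cdot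 B},\qquad \pi^0_{A,B}(b+\overline{I_t\cdot B})=t .$$ Put $j^0(b)(t)=b+\overline{I_t\cdot B}$, and for a continuous seminorm $p$ on $B$ put $p^0(b+\overline{I_t\cdot B})=\inf_{y\in\overline{I_t\cdot B}}p(b+y)$. The topology of $J^0_AB$ is generated by the sets $$W(b,U,p,\varepsilon)=\{\xi:\ \pi^0_{A,B}(\xi)\in U,\ p^0(\xi-j^0(b)(\pi^0_{A,B}(\xi)))<\varepsilon\},$$ where $b\in B$, $U\subseteq\operatorname{Spec}(A)$ is open, $p$ is a continuous seminorm on $B$, and $\varepsilon>0$. Let $\operatorname{Sec}(\pi^0_{A,B})$ be the $*$-algebra of continuous sections of $\pi^0_{A,B}$ with the fibrewise operations, and with the topology of uniform convergence on compact subsets of $\operatorname{Spec}(A)$ given by the seminorms $p^0$. **Theorem.** Every $x\in\operatorname{Sec}(\pi^0_{A,B})$ is bounded for the quotient norms of the fibres, and the map $$v:B\to\operatorname{Sec}(\pi^0_{A,B}),\qquad v(b)=j^0(b),$$ is an isomorphism of $*$-algebras, isometric for the supremum norm $\|x\|=\sup_{t\in\operatorname{Spec}(A)}\|x(t)\|$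 (with $\sup\emptyset=0$), and a homeomorphism for the topology of $\operatorname{Sec}(\pi^0_{A,B})$. Thus $\operatorname{Sec}(\pi^0_{A,B})$ is a $C^*$-algebra and $v$ is an isomorphism of $C^*$-algebras, $$B\cong\operatorname{Sec}(\pi^0_{A,B}).$$ -/

import Mathlib

open Filter Topology
open scoped Pointwise

/-! ### Stereotype spaces and involutive stereotype algebras -/

/-- The stereotype dual `X⋆` of a (complex) topological vector space `X`: the space of continuous
linear functionals on `X` with the topology of uniform convergence on totally bounded sets. -/
abbrev StereotypeDual (X : Type*) [AddCommGroup X] [Module ℂ X] [UniformSpace X] : Type _ :=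
  UniformConvergenceCLM (RingHom.id ℂ) (E := X) ℂ {S : Set X | TotallyBounded S}

theorem StereotypeDual.continuous_eval {X : Type*} [AddCommGroup X] [Module ℂ X] [UniformSpace X]
    (x : X) : Continuous (fun f : StereotypeDual X => f x) := by
  have h : ⋃₀ {S : Set X | TotallyBounded S} = Set.univ :=
    Set.eq_univ_of_forall fun y => ⟨{y}, Set.finite_singleton y |>.totallyBounded, rfl⟩
  have := UniformConvergenceCLM.continuousEvalConst (RingHom.id ℂ) (E := X) ℂ _ h
  exact this.continuous_eval_const x

/-- The canonical map `X → X⋆⋆`, `x ↦ (f ↦ f x)`. -/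
noncomputable def stereotypeEval (X : Type*) [AddCommGroup X] [Module ℂ X] [UniformSpace X] (x : X) :
    StereotypeDual (StereotypeDual X) :=
  UniformConvergenceCLM.ofFun (RingHom.id ℂ) ℂ _
    { toFun := fun f : StereotypeDual X => f x
      map_add' := fun _ _ => rfl
      map_smul' := fun _ _ => rfl
      cont := StereotypeDual.continuous_eval x }

/-- A stereotype space: a locally convex space `X` over `ℂ` for which the canonical map
`X → X⋆⋆` is an isomorphism of topological vector spaces. -/
class StereotypeSpace (X : Type*) [AddCommGroup X] [Module ℂ X] [UniformSpace X] : Prop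
    extends IsUniformAddGroup X, ContinuousSMul ℂ X, LocallyConvexSpace ℝ X where
  isHomeomorph_eval : IsHomeomorph (stereotypeEval X)

/-- An involutive stereotype algebra: a stereotype space with an associative unital
multiplication that is continuous in the stereotype sense (for every totally bounded set `S`
and every neighbourhood of zero `U` there is a neighbourhood of zero `V` with `S * V ⊆ U` and
`V * S ⊆ U`), and with a continuous involution. -/
class InvolutiveStereotypeAlgebra (A : Type*) [Ring A] [Algebra ℂ A] [StarRing A]
    [StarModule ℂ A] [UniformSpace A] : Prop extends StereotypeSpace A, ContinuousStar A where
  exists_mul_subset : ∀ S : Set A, TotallyBounded S → ∀ U ∈ 𝓝 (0 : A),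
    ∃ V ∈ 𝓝 (0 : A), S * V ⊆ U ∧ V * S ⊆ U

/-! ### The involutive spectrum -/

/-- The involutive spectrum `Spec(A)`: the set of continuous unital involutive characters
`A → ℂ`. -/
def InvolutiveSpectrum (A : Type*) [Ring A] [Algebra ℂ A] [StarRing A] [UniformSpace A] :
    Type _ :=
  {s : A →⋆ₐ[ℂ] ℂ // Continuous s}

namespace InvolutiveSpectrum

variable {A : Type*} [Ring A] [Algebra ℂ A] [StarRing A] [UniformSpace A]

instance : CoeFun (InvolutiveSpectrum A) (fun _ => A → ℂ) := ⟨fun t => t.1⟩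

/-- A character regarded as an element of the stereotype dual. -/
noncomputable def toDual (t : InvolutiveSpectrum A) : StereotypeDual A :=
  UniformConvergenceCLM.ofFun (RingHom.id ℂ) ℂ _
    { toFun := fun a => t a
      map_add' := fun a b => map_add t.1 a b
      map_smul' := fun c a => map_smul t.1 c a
      cont := t.2 }

/-- `Spec(A)` carries the topology of uniform convergence on totally bounded subsets of `A`. -/
noncomputable instance : TopologicalSpace (InvolutiveSpectrum A) :=
  TopologicalSpace.induced toDual inferInstance

theorem continuous_eval (a : A) : Continuous (fun t : InvolutiveSpectrum A => t a) :=
  (StereotypeDual.continuous_eval a).comp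
    (continuous_induced_dom : Continuous (toDual : InvolutiveSpectrum A → StereotypeDual A))

end InvolutiveSpectrum

/-! ### The value bundle of a C⋆-algebra over a commutative algebra -/

section ValueBundle

variable {A : Type*} [CommRing A] [Algebra ℂ A] [StarRing A] [UniformSpace A]
  {B : Type*} [CStarAlgebra B]

/-- The subspace `I_t · B`, where `I_t = Ker t`: all finite sums of elements `φ(a) b` with
`t(a) = 0`. -/
noncomputable def kerMul (φ : A →⋆ₐ[ℂ] B) (t : InvolutiveSpectrum A) : Submodule ℂ B :=
  Submodule.span ℂ {x | ∃ (a : A) (b : B), t a = 0 ∧ x = φ a * b}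

theorem kerMul_mul_left (φ : A →⋆ₐ[ℂ] B) (hc : ∀ a, φ a ∈ Set.center B)
    (t : InvolutiveSpectrum A) (c : B) {x : B} (hx : x ∈ kerMul φ t) : c * x ∈ kerMul φ t := by
  induction hx using Submodule.span_induction with
  | mem x hx =>
    obtain ⟨a, b, ha, rfl⟩ := hx
    refine Submodule.subset_span ⟨a, c * b, ha, ?_⟩
    rw [← mul_assoc, ← mul_assoc, ((hc a).comm c).eq]
  | zero => simp
  | add x y _ _ hx hy => rw [mul_add]; exact add_mem hx hy
  | smul k x _ hx => rw [mul_smul_comm]; exact Submodule.smul_mem _ k hx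

theorem kerMul_mul_right (φ : A →⋆ₐ[ℂ] B)
    (t : InvolutiveSpectrum A) (c : B) {x : B} (hx : x ∈ kerMul φ t) : x * c ∈ kerMul φ t := by
  induction hx using Submodule.span_induction with
  | mem x hx =>
    obtain ⟨a, b, ha, rfl⟩ := hx
    exact Submodule.subset_span ⟨a, b * c, ha, mul_assoc _ _ _⟩
  | zero => simp
  | add x y _ _ hx hy => rw [add_mul]; exact add_mem hx hy
  | smul k x _ hx => rw [smul_mul_assoc]; exact Submodule.smul_mem _ k hx

theorem kerMul_star (φ : A →⋆ₐ[ℂ] B) (hc : ∀ a, φ a ∈ Set.center B)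
    (t : InvolutiveSpectrum A) {x : B} (hx : x ∈ kerMul φ t) : star x ∈ kerMul φ t := by
  induction hx using Submodule.span_induction with
  | mem x hx =>
    obtain ⟨a, b, ha, rfl⟩ := hx
    refine Submodule.subset_span ⟨star a, star b, ?_, ?_⟩
    · have : t.1 (star a) = star (t.1 a) := map_star t.1 a
      rw [this, ha, star_zero]
    · rw [star_mul, ← map_star, ((hc (star a)).comm (star b)).eq]
  | zero => simp
  | add x y _ _ hx hy => rw [star_add]; exact add_mem hx hy
  | smul k x _ hx => rw [star_smul]; exact Submodule.smul_mem _ _ hx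

/-- The closure of `I_t · B`, which is a closed two-sided ideal because `φ(A)` is central. -/
noncomputable def valueIdeal (φ : A →⋆ₐ[ℂ] B) (hc : ∀ a, φ a ∈ Set.center B) (t : InvolutiveSpectrum A) :
    Ideal B where
  carrier := closure (kerMul φ t : Set B)
  add_mem' := (kerMul φ t).topologicalClosure.add_mem
  zero_mem' := (kerMul φ t).topologicalClosure.zero_mem
  smul_mem' c _ hx := map_mem_closure (f := fun y => c * y) (by fun_prop) hx
    fun _ hy => kerMul_mul_left φ hc t c hy

instance (φ : A →⋆ₐ[ℂ] B) (hc : ∀ a, φ a ∈ Set.center B) (t : InvolutiveSpectrum A) :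
    (valueIdeal φ hc t).IsTwoSided where
  mul_mem_of_left c hx := map_mem_closure (f := fun y => y * c) (by fun_prop) hx
    fun _ hy => kerMul_mul_right φ t c hy

instance (φ : A →⋆ₐ[ℂ] B) (hc : ∀ a, φ a ∈ Set.center B) (t : InvolutiveSpectrum A) :
    IsClosed (valueIdeal φ hc t : Set B) := isClosed_closure

/-- The fibre of the value bundle at `t`: the quotient of `B` by the closure of `I_t · B`.  It is
a complete space (`completeSpace_valueFiber`), so that passing to the pseudocompletion of the
quotient changes nothing. -/
abbrev ValueFiber (φ : A →⋆ₐ[ℂ] B) (hc : ∀ a, φ a ∈ Set.center B) (t : InvolutiveSpectrum A) :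
    Type _ :=
  B ⧸ valueIdeal φ hc t

theorem completeSpace_valueFiber (φ : A →⋆ₐ[ℂ] B) (hc : ∀ a, φ a ∈ Set.center B)
    (t : InvolutiveSpectrum A) : CompleteSpace (ValueFiber φ hc t) := inferInstance

/-- The class of `b` in the fibre at `t`, that is, `j⁰(b)(t)`. -/
noncomputable def jetValue (φ : A →⋆ₐ[ℂ] B) (hc : ∀ a, φ a ∈ Set.center B) (b : B)
    (t : InvolutiveSpectrum A) : ValueFiber φ hc t :=
  Ideal.Quotient.mk (valueIdeal φ hc t) b

/-- The involution of a fibre, induced by that of `B`. -/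
noncomputable instance (φ : A →⋆ₐ[ℂ] B) (hc : ∀ a, φ a ∈ Set.center B) (t : InvolutiveSpectrum A) :
    StarRing (ValueFiber φ hc t) where
  star := Quotient.map' star fun a b hab => by
    rw [Submodule.quotientRel_def] at hab ⊢
    rw [← star_sub]
    exact map_mem_closure (f := star) continuous_star hab fun _ hy => kerMul_star φ hc t hy
  star_involutive ξ := by
    obtain ⟨b, rfl⟩ := Ideal.Quotient.mk_surjective ξ
    exact congrArg (Ideal.Quotient.mk _) (star_star b)
  star_mul ξ ζ := by
    obtain ⟨b, rfl⟩ := Ideal.Quotient.mk_surjective ξ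
    obtain ⟨c, rfl⟩ := Ideal.Quotient.mk_surjective ζ
    exact congrArg (Ideal.Quotient.mk _) (star_mul b c)
  star_add ξ ζ := by
    obtain ⟨b, rfl⟩ := Ideal.Quotient.mk_surjective ξ
    obtain ⟨c, rfl⟩ := Ideal.Quotient.mk_surjective ζ
    exact congrArg (Ideal.Quotient.mk _) (star_add b c)

instance (φ : A →⋆ₐ[ℂ] B) (hc : ∀ a, φ a ∈ Set.center B) (t : InvolutiveSpectrum A) :
    StarModule ℂ (ValueFiber φ hc t) where
  star_smul k ξ := by
    obtain ⟨b, rfl⟩ := Ideal.Quotient.mk_surjective ξ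
    exact congrArg (Ideal.Quotient.mk _) (star_smul k b)

section Seminorm

variable (φ : A →⋆ₐ[ℂ] B) (hc : ∀ a, φ a ∈ Set.center B)

/-- The seminorm `p⁰` induced on the fibres by a seminorm `p` on `B`: the infimum of `p` over the
representatives of a class. -/
noncomputable def valueSeminorm (p : Seminorm ℂ B) {t : InvolutiveSpectrum A}
    (ξ : ValueFiber φ hc t) : ℝ :=
  sInf (p '' {b | jetValue φ hc b t = ξ})

/-- The total space `J⁰_A B` of the value bundle: the disjoint union of the fibres. -/
structure ValueBundle where
  /-- The projection to `Spec(A)`. -/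
  proj : InvolutiveSpectrum A
  /-- The point of the fibre. -/
  val : ValueFiber φ hc proj

/-- The basic open set `W(b, U, p, ε)` of the value bundle. -/
def ValueBundle.basicOpen (b : B) (U : Set (InvolutiveSpectrum A)) (p : Seminorm ℂ B) (ε : ℝ) :
    Set (ValueBundle φ hc) :=
  {ξ | ξ.proj ∈ U ∧ valueSeminorm φ hc p (ξ.val - jetValue φ hc b ξ.proj) < ε}

/-- The topology of the value bundle, generated by the sets `W(b, U, p, ε)` with `b ∈ B`, `U` open
in `Spec(A)`, `p` a continuous seminorm on `B` and `ε > 0`. -/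
instance : TopologicalSpace (ValueBundle φ hc) :=
  TopologicalSpace.generateFrom
    {W | ∃ (b : B) (U : Set (InvolutiveSpectrum A)) (p : Seminorm ℂ B) (ε : ℝ),
      IsOpen U ∧ Continuous p ∧ 0 < ε ∧ W = ValueBundle.basicOpen φ hc b U p ε}

/-- A section `t ↦ x t` of the value bundle is continuous if it is continuous as a map from
`Spec(A)` to the total space. -/
def IsContinuousSection (x : ∀ t : InvolutiveSpectrum A, ValueFiber φ hc t) : Prop :=
  Continuous fun t => (⟨t, x t⟩ : ValueBundle φ hc)

/-! Elementary facts which show that the continuous sections form a ⋆-algebra. -/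

variable {φ hc} {t : InvolutiveSpectrum A}

theorem valueSeminorm_bddBelow (p : Seminorm ℂ B) (ξ : ValueFiber φ hc t) :
    BddBelow (p '' {b | jetValue φ hc b t = ξ}) :=
  ⟨0, by rintro _ ⟨b, -, rfl⟩; exact apply_nonneg p b⟩

theorem valueSeminorm_nonneg (p : Seminorm ℂ B) (ξ : ValueFiber φ hc t) :
    0 ≤ valueSeminorm φ hc p ξ :=
  Real.sInf_nonneg (by rintro _ ⟨b, -, rfl⟩; exact apply_nonneg p b)

theorem valueSeminorm_mk_le (p : Seminorm ℂ B) (b : B) :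
    valueSeminorm φ hc p (jetValue φ hc b t) ≤ p b :=
  csInf_le (valueSeminorm_bddBelow p _) ⟨b, rfl, rfl⟩

theorem exists_lift_lt (p : Seminorm ℂ B) {ξ : ValueFiber φ hc t} {r : ℝ}
    (h : valueSeminorm φ hc p ξ < r) : ∃ b, jetValue φ hc b t = ξ ∧ p b < r := by
  obtain ⟨b₀, hb₀⟩ := Ideal.Quotient.mk_surjective ξ
  obtain ⟨_, ⟨b, hb, rfl⟩, hlt⟩ := exists_lt_of_csInf_lt (Set.Nonempty.image p ⟨b₀, hb₀⟩) h
  exact ⟨b, hb, hlt⟩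

theorem valueSeminorm_add_le (p : Seminorm ℂ B) (ξ ζ : ValueFiber φ hc t) :
    valueSeminorm φ hc p (ξ + ζ) ≤ valueSeminorm φ hc p ξ + valueSeminorm φ hc p ζ := by
  refine le_of_forall_pos_lt_add fun ε hε => ?_
  obtain ⟨b, rfl, hb⟩ := exists_lift_lt p (lt_add_of_pos_right (valueSeminorm φ hc p ξ)
    (half_pos hε))
  obtain ⟨c, rfl, hc'⟩ := exists_lift_lt p (lt_add_of_pos_right (valueSeminorm φ hc p ζ)
    (half_pos hε))
  have h1 : valueSeminorm φ hc p (jetValue φ hc b t + jetValue φ hc c t) ≤ p (b + c) :=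
    valueSeminorm_mk_le p (b + c)
  linarith [map_add_le_add p b c]

theorem valueSeminorm_smul_le (p : Seminorm ℂ B) (k : ℂ) (b : B) :
    valueSeminorm φ hc p (jetValue φ hc (k • b) t) ≤ ‖k‖ * p b :=
  (valueSeminorm_mk_le p _).trans (map_smul_eq_mul p k b).le

theorem valueSeminorm_neg_le (p : Seminorm ℂ B) (ξ : ValueFiber φ hc t) :
    valueSeminorm φ hc p (-ξ) ≤ valueSeminorm φ hc p ξ := by
  refine le_of_forall_pos_lt_add fun ε hε => ?_
  obtain ⟨b, rfl, hb⟩ := exists_lift_lt p (lt_add_of_pos_right (valueSeminorm φ hc p ξ) hε)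
  have h1 : valueSeminorm φ hc p (-jetValue φ hc b t) ≤ p (-b) := valueSeminorm_mk_le p (-b)
  rw [map_neg_eq_map] at h1
  linarith

theorem valueSeminorm_le_mul {p q : Seminorm ℂ B} {C : ℝ} (hC : 0 ≤ C) (h : ∀ b, p b ≤ C * q b)
    (ξ : ValueFiber φ hc t) : valueSeminorm φ hc p ξ ≤ C * valueSeminorm φ hc q ξ := by
  refine le_of_forall_pos_lt_add fun ε hε => ?_
  have hC1 : 0 < C + 1 := by linarith
  obtain ⟨b, rfl, hb⟩ := exists_lift_lt q (lt_add_of_pos_right (valueSeminorm φ hc q ξ)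
    (div_pos hε hC1))
  have h1 := (valueSeminorm_mk_le (φ := φ) (hc := hc) (t := t) p b).trans (h b)
  have h2 : C * (ε / (C + 1)) < ε := by
    rw [← mul_div_assoc, div_lt_iff₀ hC1]; nlinarith
  nlinarith [mul_le_mul_of_nonneg_left hb.le hC]

theorem valueSeminorm_norm_mul_le (ξ ζ : ValueFiber φ hc t) :
    valueSeminorm φ hc (normSeminorm ℂ B) (ξ * ζ) ≤
      valueSeminorm φ hc (normSeminorm ℂ B) ξ * valueSeminorm φ hc (normSeminorm ℂ B) ζ := by
  set p := normSeminorm ℂ B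
  have key : ∀ r > valueSeminorm φ hc p ξ, ∀ s > valueSeminorm φ hc p ζ,
      valueSeminorm φ hc p (ξ * ζ) ≤ r * s := by
    intro r hr s hs
    obtain ⟨b, rfl, hb⟩ := exists_lift_lt p hr
    obtain ⟨c, rfl, hc'⟩ := exists_lift_lt p hs
    have h1 : valueSeminorm φ hc p (jetValue φ hc b t * jetValue φ hc c t) ≤ p (b * c) :=
      valueSeminorm_mk_le p (b * c)
    exact h1.trans ((norm_mul_le b c).trans
      (mul_le_mul hb.le hc'.le (norm_nonneg c) ((norm_nonneg b).trans hb.le)))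
  have hlim : Tendsto (fun ε : ℝ => (valueSeminorm φ hc p ξ + ε) * (valueSeminorm φ hc p ζ + ε))
      (𝓝[>] 0) (𝓝 ((valueSeminorm φ hc p ξ + 0) * (valueSeminorm φ hc p ζ + 0))) :=
    (Continuous.tendsto (by fun_prop) 0).mono_left nhdsWithin_le_nhds
  rw [add_zero, add_zero] at hlim
  refine ge_of_tendsto hlim ?_
  filter_upwards [self_mem_nhdsWithin] with ε hε
  exact key _ (lt_add_of_pos_right _ hε) _ (lt_add_of_pos_right _ hε)

theorem valueSeminorm_norm_star_le (ξ : ValueFiber φ hc t) :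
    valueSeminorm φ hc (normSeminorm ℂ B) (star ξ) ≤
      valueSeminorm φ hc (normSeminorm ℂ B) ξ := by
  refine le_of_forall_pos_lt_add fun ε hε => ?_
  obtain ⟨b, rfl, hb⟩ := exists_lift_lt _
    (lt_add_of_pos_right (valueSeminorm φ hc (normSeminorm ℂ B) ξ) hε)
  have h1 : valueSeminorm φ hc (normSeminorm ℂ B) (star (jetValue φ hc b t)) ≤ ‖star b‖ :=
    valueSeminorm_mk_le (normSeminorm ℂ B) (star b)
  rw [norm_star] at h1
  exact h1.trans_lt hb

theorem eventually_valueSeminorm_lt_of_mem_kerMul {p : Seminorm ℂ B} {d : B}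
    (hd : d ∈ kerMul φ t) :
    ∀ η > 0, ∀ᶠ s in 𝓝 t, valueSeminorm φ hc p (jetValue φ hc d s) < η := by
  induction hd using Submodule.span_induction with
  | mem x hx =>
    intro η hη
    obtain ⟨a, b, ha, rfl⟩ := hx
    have hlim : Tendsto (fun s : InvolutiveSpectrum A => ‖s a‖ * p b) (𝓝 t) (𝓝 0) := by
      have h1 := (((InvolutiveSpectrum.continuous_eval a).norm.mul_const (p b)).tendsto t)
      simpa [ha] using h1
    filter_upwards [hlim.eventually (gt_mem_nhds hη)] with s hs
    have heq : jetValue φ hc (φ a * b) s = jetValue φ hc (s a • b) s := by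
      refine Ideal.Quotient.eq.2 (subset_closure (Submodule.subset_span
        ⟨a - algebraMap ℂ A (s a), b, ?_, ?_⟩))
      · have : s.1 (algebraMap ℂ A (s.1 a)) = s.1 a := AlgHomClass.commutes s.1 _
        rw [map_sub, this, sub_self]
      · rw [map_sub, AlgHomClass.commutes, sub_mul, Algebra.smul_def]
    rw [heq]
    exact (valueSeminorm_smul_le p _ b).trans_lt hs
  | zero =>
    intro η hη
    refine Eventually.of_forall fun s => (valueSeminorm_mk_le p 0).trans_lt ?_
    rwa [map_zero]
  | add x y _ _ hx hy =>
    intro η hη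
    filter_upwards [hx _ (half_pos hη), hy _ (half_pos hη)] with s h1 h2
    have h3 : valueSeminorm φ hc p (jetValue φ hc (x + y) s) ≤ _ :=
      valueSeminorm_add_le p (jetValue φ hc x s) (jetValue φ hc y s)
    linarith
  | smul k x _ hx =>
    intro η hη
    have hk : 0 < ‖k‖ + 1 := by positivity
    filter_upwards [hx _ (div_pos hη hk)] with s h1
    obtain ⟨b, hb, hlt⟩ := exists_lift_lt p h1
    have h2 : jetValue φ hc (k • x) s = jetValue φ hc (k • b) s := by
      change k • jetValue φ hc x s = k • jetValue φ hc b s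
      rw [hb]
    rw [h2]
    refine (valueSeminorm_smul_le p k b).trans_lt ?_
    rw [lt_div_iff₀ hk] at hlt
    nlinarith [apply_nonneg p b]

theorem eventually_valueSeminorm_lt {p : Seminorm ℂ B} (hp : Continuous p) {b : B} {ε : ℝ}
    (h : valueSeminorm φ hc p (jetValue φ hc b t) < ε) :
    ∀ᶠ s in 𝓝 t, valueSeminorm φ hc p (jetValue φ hc b s) < ε := by
  obtain ⟨c, hcb, hlt⟩ := exists_lift_lt p h
  have hmem : c - b ∈ closure (kerMul φ t : Set B) := Ideal.Quotient.eq.1 hcb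
  have hopen : {y : B | p (b + y) < ε} ∈ 𝓝 (c - b) := by
    refine (isOpen_lt (by fun_prop) continuous_const).mem_nhds ?_
    simpa using hlt
  obtain ⟨d, hd1, hd2⟩ := mem_closure_iff_nhds.1 hmem _ hopen
  filter_upwards [eventually_valueSeminorm_lt_of_mem_kerMul (φ := φ) (hc := hc) (p := p) hd2
    (ε - p (b + d)) (sub_pos.2 hd1)] with s hs
  have h1 : jetValue φ hc b s = jetValue φ hc (b + d) s + -jetValue φ hc d s := by
    change Ideal.Quotient.mk _ b = Ideal.Quotient.mk _ (b + d) + -Ideal.Quotient.mk _ d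
    rw [map_add]; abel
  have h2 := valueSeminorm_add_le p (jetValue φ hc (b + d) s) (-jetValue φ hc d s)
  have h3 := valueSeminorm_neg_le p (jetValue φ hc d s)
  have h4 := valueSeminorm_mk_le (φ := φ) (hc := hc) (t := s) p (b + d)
  rw [h1]
  linarith

theorem isContinuousSection_iff {x : ∀ t : InvolutiveSpectrum A, ValueFiber φ hc t} :
    IsContinuousSection φ hc x ↔ ∀ t, ∀ ε > 0, ∃ b : B, ∀ᶠ s in 𝓝 t,
      valueSeminorm φ hc (normSeminorm ℂ B) (x s - jetValue φ hc b s) < ε := by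
  have hn : Continuous (normSeminorm ℂ B) := continuous_norm
  constructor
  · intro hx t ε hε
    obtain ⟨b, hb⟩ := Ideal.Quotient.mk_surjective (x t)
    have hopen : IsOpen (ValueBundle.basicOpen φ hc b Set.univ (normSeminorm ℂ B) ε) :=
      TopologicalSpace.isOpen_generateFrom_of_mem
        ⟨b, Set.univ, _, ε, isOpen_univ, hn, hε, rfl⟩
    have hmem : t ∈ (fun t => (⟨t, x t⟩ : ValueBundle φ hc)) ⁻¹'
        ValueBundle.basicOpen φ hc b Set.univ (normSeminorm ℂ B) ε := by
      refine ⟨trivial, ?_⟩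
      change valueSeminorm φ hc (normSeminorm ℂ B) (x t - jetValue φ hc b t) < ε
      have h0 : x t - jetValue φ hc b t = jetValue φ hc 0 t := by
        change x t - Ideal.Quotient.mk _ b = Ideal.Quotient.mk _ 0
        rw [hb, sub_self, map_zero]
      rw [h0]
      refine (valueSeminorm_mk_le (φ := φ) (hc := hc) (normSeminorm ℂ B) 0).trans_lt ?_
      rwa [map_zero]
    exact ⟨b, Filter.mem_of_superset ((hopen.preimage hx).mem_nhds hmem) fun s hs => hs.2⟩
  · intro hx
    refine continuous_generateFrom_iff.2 ?_
    rintro _ ⟨c, U, q, δ, hU, hq, hδ, rfl⟩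
    obtain ⟨C, hC0, hC⟩ := Seminorm.bound_of_continuous_normedSpace q hq
    refine isOpen_iff_mem_nhds.2 fun t ht => ?_
    have ht2 : valueSeminorm φ hc q (x t - jetValue φ hc c t) < δ := ht.2
    set m := valueSeminorm φ hc q (x t - jetValue φ hc c t)
    obtain ⟨b, hb⟩ := hx t ((δ - m) / (2 * C)) (div_pos (sub_pos.2 ht2) (by positivity))
    have hbnd : ∀ s, valueSeminorm φ hc (normSeminorm ℂ B) (x s - jetValue φ hc b s) <
        (δ - m) / (2 * C) →
        valueSeminorm φ hc q (x s - jetValue φ hc b s) < (δ - m) / 2 := by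
      intro s hs
      refine (valueSeminorm_le_mul hC0.le hC _).trans_lt
        ((mul_lt_mul_of_pos_left hs hC0).trans_eq ?_)
      field_simp
    have hsub : ∀ s, jetValue φ hc (b - c) s =
        jetValue φ hc b s - jetValue φ hc c s := fun s => map_sub (Ideal.Quotient.mk _) b c
    have h1 : valueSeminorm φ hc q (jetValue φ hc (b - c) t) < (δ - m) / 2 + m := by
      have e : jetValue φ hc (b - c) t =
          -(x t - jetValue φ hc b t) + (x t - jetValue φ hc c t) := by rw [hsub]; abel
      rw [e]
      have := valueSeminorm_add_le q (-(x t - jetValue φ hc b t)) (x t - jetValue φ hc c t)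
      have := valueSeminorm_neg_le q (x t - jetValue φ hc b t)
      have := hbnd t hb.self_of_nhds
      linarith
    filter_upwards [hb, eventually_valueSeminorm_lt hq h1, hU.mem_nhds ht.1] with s hs1 hs2 hs3
    refine ⟨hs3, ?_⟩
    change valueSeminorm φ hc q (x s - jetValue φ hc c s) < δ
    have e : x s - jetValue φ hc c s = (x s - jetValue φ hc b s) + jetValue φ hc (b - c) s := by
      rw [hsub]; abel
    rw [e]
    have := valueSeminorm_add_le q (x s - jetValue φ hc b s) (jetValue φ hc (b - c) s)
    have := hbnd s hs1
    linarith

theorem isContinuousSection_jetValue (b : B) : IsContinuousSection φ hc (jetValue φ hc b) := by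
  refine isContinuousSection_iff.2 fun t ε hε => ⟨b, Eventually.of_forall fun s => ?_⟩
  rw [sub_self]
  refine (valueSeminorm_mk_le (φ := φ) (hc := hc) (t := s) (normSeminorm ℂ B) 0).trans_lt ?_
  rwa [map_zero]

theorem IsContinuousSection.add {x y : ∀ t : InvolutiveSpectrum A, ValueFiber φ hc t}
    (hx : IsContinuousSection φ hc x) (hy : IsContinuousSection φ hc y) :
    IsContinuousSection φ hc (x + y) := by
  rw [isContinuousSection_iff] at hx hy ⊢
  intro t ε hε
  obtain ⟨b, hb⟩ := hx t _ (half_pos hε)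
  obtain ⟨c, hc'⟩ := hy t _ (half_pos hε)
  refine ⟨b + c, ?_⟩
  filter_upwards [hb, hc'] with s h1 h2
  have e : (x + y) s - jetValue φ hc (b + c) s =
      (x s - jetValue φ hc b s) + (y s - jetValue φ hc c s) := by
    change x s + y s - Ideal.Quotient.mk _ (b + c) =
      (x s - Ideal.Quotient.mk _ b) + (y s - Ideal.Quotient.mk _ c)
    rw [map_add]; abel
  rw [e]
  linarith [valueSeminorm_add_le (normSeminorm ℂ B) (x s - jetValue φ hc b s)
    (y s - jetValue φ hc c s)]

theorem IsContinuousSection.star {x : ∀ t : InvolutiveSpectrum A, ValueFiber φ hc t}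
    (hx : IsContinuousSection φ hc x) : IsContinuousSection φ hc (star x) := by
  rw [isContinuousSection_iff] at hx ⊢
  intro t ε hε
  obtain ⟨b, hb⟩ := hx t ε hε
  refine ⟨Star.star b, ?_⟩
  filter_upwards [hb] with s h1
  have e : (Star.star x) s - jetValue φ hc (Star.star b) s =
      Star.star (x s - jetValue φ hc b s) := (star_sub (x s) (jetValue φ hc b s)).symm
  rw [e]
  exact (valueSeminorm_norm_star_le _).trans_lt h1

theorem IsContinuousSection.mul {x y : ∀ t : InvolutiveSpectrum A, ValueFiber φ hc t}
    (hx : IsContinuousSection φ hc x) (hy : IsContinuousSection φ hc y) :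
    IsContinuousSection φ hc (x * y) := by
  rw [isContinuousSection_iff] at hx hy ⊢
  intro t ε hε
  obtain ⟨c₀, hc₀⟩ := hy t 1 one_pos
  have hM : 0 < ‖c₀‖ + 1 := by positivity
  obtain ⟨b, hb⟩ := hx t (ε / 2 / (‖c₀‖ + 1)) (by positivity)
  have hK : 0 < ‖b‖ + 1 := by positivity
  obtain ⟨c, hc'⟩ := hy t (ε / 2 / (‖b‖ + 1)) (by positivity)
  refine ⟨b * c, ?_⟩
  filter_upwards [hc₀, hb, hc'] with s h0 h1 h2
  set p := normSeminorm ℂ B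
  have e : (x * y) s - jetValue φ hc (b * c) s =
      (x s - jetValue φ hc b s) * y s + jetValue φ hc b s * (y s - jetValue φ hc c s) := by
    change x s * y s - Ideal.Quotient.mk _ (b * c) =
      (x s - Ideal.Quotient.mk _ b) * y s + Ideal.Quotient.mk _ b * (y s - Ideal.Quotient.mk _ c)
    rw [map_mul]; noncomm_ring
  have hy' : valueSeminorm φ hc p (y s) ≤ ‖c₀‖ + 1 := by
    have h3 := valueSeminorm_add_le p (y s - jetValue φ hc c₀ s) (jetValue φ hc c₀ s)
    rw [sub_add_cancel] at h3
    have h4 : valueSeminorm φ hc p (jetValue φ hc c₀ s) ≤ ‖c₀‖ := valueSeminorm_mk_le p c₀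
    linarith
  have hb' : valueSeminorm φ hc p (jetValue φ hc b s) ≤ ‖b‖ + 1 :=
    (valueSeminorm_mk_le p b).trans (le_add_of_nonneg_right zero_le_one)
  rw [e]
  refine (valueSeminorm_add_le p _ _).trans_lt ?_
  have a1 := valueSeminorm_norm_mul_le (x s - jetValue φ hc b s) (y s)
  have a2 := valueSeminorm_norm_mul_le (jetValue φ hc b s) (y s - jetValue φ hc c s)
  rw [lt_div_iff₀ hM] at h1
  rw [lt_div_iff₀ hK] at h2
  have a3 := mul_le_mul_of_nonneg_left hy'
    (valueSeminorm_nonneg p (x s - jetValue φ hc b s))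
  have a4 := mul_le_mul_of_nonneg_right hb'
    (valueSeminorm_nonneg p (y s - jetValue φ hc c s))
  linarith

end Seminorm

/-- The ⋆-algebra `Sec(π⁰_{A,B})` of continuous sections of the value bundle, with the fibrewise
operations. -/
def continuousSections (φ : A →⋆ₐ[ℂ] B) (hc : ∀ a, φ a ∈ Set.center B) :
    StarSubalgebra ℂ (∀ t : InvolutiveSpectrum A, ValueFiber φ hc t) where
  carrier := {x | IsContinuousSection φ hc x}
  mul_mem' hx hy := hx.mul hy
  add_mem' hx hy := hx.add hy
  algebraMap_mem' k := isContinuousSection_jetValue (algebraMap ℂ B k)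
  star_mem' hx := hx.star

/-- The norm of the value of a section at a point (the quotient norm in the fibre). -/
noncomputable def sectionNormAt (φ : A →⋆ₐ[ℂ] B) (hc : ∀ a, φ a ∈ Set.center B)
    (x : continuousSections φ hc) (t : InvolutiveSpectrum A) : ℝ :=
  valueSeminorm φ hc (normSeminorm ℂ B) (x.1 t)

/-- The supremum norm of a section (equal to `0` if `Spec(A)` is empty). -/
noncomputable def sectionNorm (φ : A →⋆ₐ[ℂ] B) (hc : ∀ a, φ a ∈ Set.center B)
    (x : continuousSections φ hc) : ℝ :=
  ⨆ t, sectionNormAt φ hc x t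

/-- The topology of `Sec(π⁰_{A,B})`: uniform convergence on compact subsets of `Spec(A)` with
respect to the seminorms `p⁰`.  (For a continuous section the upper semicontinuous function
`t ↦ p⁰(y(t) - x(t))` attains its maximum on a nonempty compact set, so the set below is the ball
`sup_{t ∈ T} p⁰(y(t) - x(t)) < ε`.) -/
abbrev sectionTopology (φ : A →⋆ₐ[ℂ] B) (hc : ∀ a, φ a ∈ Set.center B) :
    TopologicalSpace (continuousSections φ hc) :=
  TopologicalSpace.generateFrom
    {V | ∃ (x : continuousSections φ hc) (T : Set (InvolutiveSpectrum A)) (p : Seminorm ℂ B)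
      (ε : ℝ), IsCompact T ∧ Continuous p ∧ 0 < ε ∧
        V = {y | ∀ t ∈ T, valueSeminorm φ hc p (y.1 t - x.1 t) < ε}}

end ValueBundle

/-! The closure of `φ(A)` is a central commutative C⋆-subalgebra of `B`, hence a copy of `C(K)` with
`K` compact Hausdorff, and `φ` factors as `ι ∘ α` with `α : A → C(K)` of dense range. Evaluation at
points of `K` gives a continuous map from `K` to `Spec(A)`, so its image `T` is compact. Over a
character outside `T` the fibre is zero (`jetValue_eq_zero_of_notMem_range`), so everything happens
over `T`, where `B` is a module over `C(K)` and partitions of unity are available.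

Two gluing arguments carry the theorem. For the norm: if all fibre norms of `b` over `T` are below
`r`, then near each point `b` agrees, as seen by functions supported there, with an element of norm
at most `r`; a partition of unity with central coefficients reassembles `b` without increasing the
bound (`norm_le_of_forall_norm_jetValue_lt`). Hence the supremum over `T` already dominates `‖b‖`,
which gives isometry and injectivity. For surjectivity: a continuous section is locally close to
some `j⁰(b)`, and the same kind of partition glues these into a uniform approximation
(`exists_forall_norm_sub_jetValue_le`). By the norm estimate such approximations form a Cauchy
sequence, whose limit represents the section.

The topologies agree because the compact set `T` alone controls the norm, while continuity of `v`
follows from `p⁰ ≤ p` and upper semicontinuity of `p⁰`. -/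

/-! ### Partitions of unity and a convexity inequality in C⋆-algebras. -/

/-- Square roots of an ordinary partition of unity. The form `star h * h` is what survives a
⋆-homomorphism as a visibly positive weight. -/
theorem exists_finite_star_mul_self_partition {K : Type*} [TopologicalSpace K] [CompactSpace K]
    [T2Space K] (V : K → Set K) (hV : ∀ x, V x ∈ 𝓝 x) :
    ∃ (s : Finset K) (h : K → C(K, ℂ)), ∑ i ∈ s, star (h i) * h i = 1 ∧
      ∀ i y, h i y ≠ 0 → y ∈ V i := by
  obtain ⟨ρ, hρ⟩ := PartitionOfUnity.exists_isSubordinate (isClosed_univ (X := K))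
    (fun x => interior (V x)) (fun x => isOpen_interior)
    (fun x _ => Set.mem_iUnion.2 ⟨x, mem_interior_iff_mem_nhds.2 (hV x)⟩)
  -- Local finiteness on a compact space leaves only finitely many nonzero members.
  have hfin := ρ.locallyFinite.finite_nonempty_of_compact
  refine ⟨hfin.toFinset, fun i => ⟨fun y => (Real.sqrt (ρ i y) : ℂ), by fun_prop⟩, ?_, ?_⟩
  · ext y
    have h1 := ρ.sum_eq_one (Set.mem_univ y)
    rw [finsum_eq_sum_of_support_subset (s := hfin.toFinset)] at h1
    · rw [ContinuousMap.sum_apply]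
      have h2 : ∀ i, star (Real.sqrt (ρ i y) : ℂ) * (Real.sqrt (ρ i y) : ℂ) = (ρ i y : ℂ) := by
        intro i
        rw [Complex.star_def, Complex.conj_ofReal, ← Complex.ofReal_mul,
          Real.mul_self_sqrt (ρ.nonneg i y)]
      simp only [ContinuousMap.mul_apply, ContinuousMap.star_apply, ContinuousMap.coe_mk, h2,
        ContinuousMap.one_apply]
      rw [← Complex.ofReal_sum, h1, Complex.ofReal_one]
    · intro i hi
      simp only [Set.Finite.coe_toFinset, Set.mem_ofPred_eq]
      exact ⟨y, hi⟩
  · intro i y hy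
    refine interior_subset (hρ i (subset_tsupport _ ?_))
    intro h0
    apply hy
    simp [h0]

/-- A variance inequality: for the weighted mean `a` of the `g i`, the positive element `∑ |c i (g i
- a)|²` equals `∑ |c i g i|² - a⋆a`, so `a⋆a ≤ ∑ |c i g i|² ≤ r²`. Centrality of the `c i` lets the
weights pass through. The triangle inequality alone would bring in the sum of the norms of the
weights, which need not be `1`. -/
theorem norm_sum_star_mul_self_mul_le {B κ : Type*} [CStarAlgebra B] (s : Finset κ) (c g : κ → B)
    (hc : ∀ i, c i ∈ Set.center B) (hsum : ∑ i ∈ s, star (c i) * c i = 1) {r : ℝ} (hr : 0 ≤ r)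
    (hg : ∀ i, ‖g i‖ ≤ r) : ‖∑ i ∈ s, star (c i) * c i * g i‖ ≤ r := by
  let _ := CStarAlgebra.spectralOrder B
  let _ := CStarAlgebra.spectralOrderedRing B
  set a := ∑ i ∈ s, star (c i) * c i * g i with ha
  have hcc : ∀ i x, x * c i = c i * x := fun i x => ((hc i).comm x).eq.symm
  have hcs : ∀ i x, x * star (c i) = star (c i) * x := fun i x =>
    ((Set.star_mem_center (hc i)).comm x).eq.symm
  have e : ∀ i, ∀ x y : B, star (c i * x) * (c i * y) = star x * (star (c i) * c i * y) := by
    intro i x y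
    rw [star_mul]; simp only [mul_assoc]
  have hpos : 0 ≤ ∑ i ∈ s, star (c i * (g i - a)) * (c i * (g i - a)) :=
    Finset.sum_nonneg fun i _ => star_mul_self_nonneg _
  have hstar : star a = ∑ i ∈ s, star (g i) * (star (c i) * c i) := by
    rw [ha, star_sum]
    refine Finset.sum_congr rfl fun i _ => ?_
    rw [star_mul, star_mul, star_star]
  have hexp : ∑ i ∈ s, star (c i * (g i - a)) * (c i * (g i - a)) =
      ∑ i ∈ s, star (c i * g i) * (c i * g i) - star a * a := by
    have h1 : ∀ i, star (c i * (g i - a)) * (c i * (g i - a)) =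
        star (c i * g i) * (c i * g i) - star (g i) * (star (c i) * c i) * a
          - star a * (star (c i) * c i * g i) + star a * (star (c i) * c i) * a := by
      intro i
      rw [e, e, star_sub]; noncomm_ring
    simp only [h1, Finset.sum_add_distrib, Finset.sum_sub_distrib, ← Finset.mul_sum,
      ← Finset.sum_mul, ← hstar, hsum, ← ha]
    noncomm_ring
  have hle : ∑ i ∈ s, star (c i * g i) * (c i * g i) ≤ algebraMap ℝ B (r ^ 2) := by
    have h1 : ∀ i, star (c i * g i) * (c i * g i) ≤ star (c i) * algebraMap ℝ B (r ^ 2) * c i := by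
      intro i
      have h2 : star (c i * g i) * (c i * g i) = star (c i) * (star (g i) * g i) * c i := by
        rw [e, ← mul_assoc, ← mul_assoc, hcs, mul_assoc _ (c i), ← hcc]; simp only [mul_assoc]
      rw [h2]
      refine star_left_conjugate_le_conjugate ?_ _
      refine CStarAlgebra.star_mul_le_algebraMap_norm_sq.trans (algebraMap_mono B ?_)
      gcongr
      exact hg i
    refine (Finset.sum_le_sum fun i _ => h1 i).trans_eq ?_
    have h3 : ∀ i, star (c i) * algebraMap ℝ B (r ^ 2) * c i =
        algebraMap ℝ B (r ^ 2) * (star (c i) * c i) := by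
      intro i
      rw [← Algebra.commutes, mul_assoc]
    simp only [h3, ← Finset.mul_sum, hsum, mul_one]
  rw [hexp, sub_nonneg] at hpos
  have h4 := (CStarAlgebra.norm_le_iff_le_algebraMap (star a * a) (sq_nonneg r)
    (star_mul_self_nonneg a)).2 (hpos.trans hle)
  rw [CStarRing.norm_star_mul_self, ← sq] at h4
  exact le_of_sq_le_sq h4 hr

/-! ### The seminorm of the fibres as the quotient norm. -/

section QuotientNorm

variable {A : Type*} [CommRing A] [Algebra ℂ A] [StarRing A] [UniformSpace A]
  {B : Type*} [CStarAlgebra B] {φ : A →⋆ₐ[ℂ] B} {hc : ∀ a, φ a ∈ Set.center B}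

theorem valueSeminorm_normSeminorm_eq_norm {t : InvolutiveSpectrum A} (ξ : ValueFiber φ hc t) :
    valueSeminorm φ hc (normSeminorm ℂ B) ξ = ‖ξ‖ := by
  refine le_antisymm ?_ ?_
  · refine le_of_forall_pos_lt_add fun ε hε => ?_
    obtain ⟨b, rfl, hb⟩ := Submodule.Quotient.norm_mk_lt ξ hε
    exact (valueSeminorm_mk_le (φ := φ) (hc := hc) (normSeminorm ℂ B) b).trans_lt hb
  · refine le_of_forall_pos_lt_add fun ε hε => ?_
    obtain ⟨b, rfl, hb⟩ := exists_lift_lt (normSeminorm ℂ B)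
      (lt_add_of_pos_right (valueSeminorm φ hc (normSeminorm ℂ B) ξ) hε)
    exact (Submodule.Quotient.norm_mk_le _ b).trans_lt hb

end QuotientNorm

/-! ### Localization over `K` when `φ` factors through `C(K)`. -/

section FactorThroughContinuousFunctions

variable {A : Type*} [CommRing A] [Algebra ℂ A] [StarRing A] [UniformSpace A]
  {B : Type*} [CStarAlgebra B]
  {K : Type*} [TopologicalSpace K]

/-- The character `a ↦ α(a)(x)` defined by a point `x` of a compact space `K` and a continuous
homomorphism `α : A → C(K)`. -/
noncomputable def pointCharacter (α : A →⋆ₐ[ℂ] C(K, ℂ)) (hα : Continuous α) (x : K) :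
    InvolutiveSpectrum A :=
  ⟨(ContinuousMap.evalStarAlgHom ℂ ℂ x).comp α, (continuous_eval_const x).comp hα⟩

theorem pointCharacter_apply (α : A →⋆ₐ[ℂ] C(K, ℂ)) (hα : Continuous α) (x : K) (a : A) :
    pointCharacter α hα x a = α a x := rfl

variable {φ : A →⋆ₐ[ℂ] B} {hc : ∀ a, φ a ∈ Set.center B}
  {ι : C(K, ℂ) →⋆ₐ[ℂ] B} {α : A →⋆ₐ[ℂ] C(K, ℂ)} {hα : Continuous α}

/-- Coefficients from `C(K)` are absorbed into the arbitrary factor `b`, so passing from `α(I_t)` to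
the ideal it generates does not enlarge `I_t · B`. -/
theorem map_mul_mem_kerMul (hφ : ∀ a, φ a = ι (α a)) (t : InvolutiveSpectrum A) {f : C(K, ℂ)}
    (hf : f ∈ Ideal.span {f | ∃ a, t a = 0 ∧ α a = f}) (b : B) : ι f * b ∈ kerMul φ t := by
  induction hf using Submodule.span_induction generalizing b with
  | mem f hf =>
    obtain ⟨a, ha, rfl⟩ := hf
    exact Submodule.subset_span ⟨a, b, ha, by rw [hφ]⟩
  | zero => simp
  | add f g _ _ hf hg => rw [map_add, add_mul]; exact add_mem (hf b) (hg b)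
  | smul g f _ hf => rw [smul_eq_mul, mul_comm, map_mul, mul_assoc]; exact hf _

variable [CompactSpace K]

/-- The image under `α` of a totally bounded set is totally bounded in `C(K)`, hence equicontinuous:
a finite `ε/3`-net reduces the claim to continuity of finitely many functions. -/
theorem continuous_pointCharacter [IsUniformAddGroup A] (α : A →⋆ₐ[ℂ] C(K, ℂ))
    (hα : Continuous α) : Continuous (pointCharacter α hα) := by
  refine continuous_induced_rng.2 (continuous_iff_continuousAt.2 fun x => ?_)
  refine (UniformConvergenceCLM.tendsto_iff_tendstoUniformlyOn (RingHom.id ℂ) (E := A) ℂ _).2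
    fun S hS => ?_
  have hS' : TotallyBounded S := hS
  have huc : UniformContinuous α := uniformContinuous_addMonoidHom_of_continuous (f := α) hα
  rw [Metric.tendstoUniformlyOn_iff]
  intro ε hε
  obtain ⟨N, hN, hcov⟩ := Metric.totallyBounded_iff.1 (hS'.image huc) (ε / 3) (by positivity)
  have hev : ∀ᶠ y in 𝓝 x, ∀ f ∈ N, dist (f x) (f y) < ε / 3 := by
    refine (hN.eventually_all (l := 𝓝 x)).2 fun f _ => ?_
    have := Metric.tendsto_nhds.1 (f.continuous.tendsto x) (ε / 3) (by positivity)
    simpa only [dist_comm] using this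
  filter_upwards [hev] with y hy a ha
  obtain ⟨f, hf, hfa⟩ := Set.mem_iUnion₂.1 (hcov ⟨a, ha, rfl⟩)
  change dist (α a x) (α a y) < ε
  have h1 := (ContinuousMap.dist_apply_le_dist (f := α a) (g := f) x).trans_lt hfa
  have h2 := (ContinuousMap.dist_apply_le_dist (f := α a) (g := f) y).trans_lt hfa
  have h3 := hy f hf
  have h4 := dist_triangle4 (α a x) (f x) (f y) (α a y)
  rw [dist_comm (f y)] at h4
  linarith

/-- If `α(I_t)` generated a proper ideal of `C(K)`, a maximal ideal above it would be the functions
vanishing at some `x`, forcing `t` to be evaluation at `x`. Otherwise `1` lies in the ideal and `I_t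
· B` is all of `B`. -/
theorem jetValue_eq_zero_of_notMem_range [T2Space K] (hφ : ∀ a, φ a = ι (α a)) {t : InvolutiveSpectrum A}
    (ht : t ∉ Set.range (pointCharacter α hα)) (b : B) : jetValue φ hc b t = 0 := by
  have htop : Ideal.span {f | ∃ a, t a = 0 ∧ α a = f} = ⊤ := by
    by_contra hne
    obtain ⟨M, hM, hle⟩ := Ideal.exists_le_maximal _ hne
    obtain ⟨x, hx⟩ := ContinuousMap.setOfIdeal_eq_compl_singleton (𝕜 := ℂ) M
    refine ht ⟨x, Subtype.ext (StarAlgHom.ext fun a => ?_)⟩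
    have h0 : t (a - algebraMap ℂ A (t a)) = 0 := by
      have : t.1 (algebraMap ℂ A (t.1 a)) = t.1 a := AlgHomClass.commutes t.1 _
      rw [map_sub, this, sub_self]
    have hx' : x ∉ ContinuousMap.setOfIdeal M := by simp [hx]
    have h1 := ContinuousMap.notMem_setOfIdeal.1 hx' (hle (Ideal.subset_span ⟨_, h0, rfl⟩))
    rw [map_sub, AlgHomClass.commutes, ContinuousMap.sub_apply, sub_eq_zero] at h1
    exact h1
  refine Ideal.Quotient.eq_zero_iff_mem.2 (subset_closure ?_)
  have := map_mul_mem_kerMul (ι := ι) hφ t (f := 1) (htop ▸ Submodule.mem_top) b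
  rwa [map_one, one_mul] at this

/-- For `f = α a` the difference `a - α(a)(x)` lies in the kernel of the character; density of the
range extends this to all `f` because the ideal is closed. -/
theorem jetValue_map_mul (hd : DenseRange α) (hφ : ∀ a, φ a = ι (α a)) (f : C(K, ℂ)) (b : B)
    (x : K) : jetValue φ hc (ι f * b) (pointCharacter α hα x) =
      f x • jetValue φ hc b (pointCharacter α hα x) := by
  have hι : Continuous ι := AddMonoidHomClass.continuous_of_bound ι 1 fun f => by
    rw [one_mul]; exact NonUnitalStarAlgHom.norm_apply_le ι f
  have hcont : Continuous fun g : C(K, ℂ) => ι g * b - g x • b :=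
    (hι.mul continuous_const).sub ((continuous_eval_const x).smul continuous_const)
  refine Ideal.Quotient.eq.2 (?_ : ι f * b - f x • b ∈
    closure (kerMul φ (pointCharacter α hα x) : Set B))
  refine hd.induction_on (p := fun g => ι g * b - g x • b ∈
    closure (kerMul φ (pointCharacter α hα x) : Set B)) f
    (isClosed_closure.preimage hcont) fun a => subset_closure ?_
  refine Submodule.subset_span ⟨a - algebraMap ℂ A (α a x), b, ?_, ?_⟩
  · rw [pointCharacter_apply, map_sub, AlgHomClass.commutes, ContinuousMap.sub_apply]
    exact sub_self _
  · rw [map_sub, AlgHomClass.commutes, sub_mul, Algebra.smul_def, hφ]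

/-- A generator `φ(a) b` has `α(a)(x) = 0`, so it becomes small when cut off to a neighbourhood
where `α(a)` is small; sums are handled by multiplying cutoffs. -/
theorem exists_cutoff (hφ : ∀ a, φ a = ι (α a)) {x : K} {d : B}
    (hd : d ∈ kerMul φ (pointCharacter α hα x)) :
    ∀ ε > 0, ∃ k : C(K, ℂ), (∀ᶠ y in 𝓝 x, k y = 1) ∧ ‖k‖ ≤ 1 ∧ ‖ι k * d‖ < ε := by
  have hone : ‖(1 : C(K, ℂ))‖ ≤ 1 :=
    (ContinuousMap.norm_le _ zero_le_one).2 fun y => by simp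
  have hmul : ∀ (k : C(K, ℂ)) (b : B), ‖k‖ ≤ 1 → ‖ι k * b‖ ≤ ‖b‖ := fun k b hk =>
    (norm_mul_le _ _).trans (mul_le_of_le_one_left (norm_nonneg b)
      ((NonUnitalStarAlgHom.norm_apply_le ι k).trans hk))
  induction hd using Submodule.span_induction with
  | mem d hd =>
    obtain ⟨a, b, ha, rfl⟩ := hd
    intro ε hε
    set η : ℝ := ε / (2 * (‖b‖ + 1)) / 2 with hη
    have hη0 : 0 < η := by positivity
    -- This equals `1` where `|α(a)| ≤ η` and `0` where `|α(a)| ≥ 2η`, so `‖k α(a)‖ ≤ 2η`; the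
    -- choice of `η` then keeps the product with `b` below `ε`.
    set k : C(K, ℂ) := ⟨fun y => ((max 0 (min 1 (2 - ‖α a y‖ / η)) : ℝ) : ℂ), by fun_prop⟩ with hk
    have hky : ∀ y, ‖k y‖ = max 0 (min 1 (2 - ‖α a y‖ / η)) := fun y => by
      rw [hk, ContinuousMap.coe_mk, Complex.norm_real, Real.norm_of_nonneg (le_max_left _ _)]
    refine ⟨k, ?_, (ContinuousMap.norm_le _ zero_le_one).2 fun y => ?_, ?_⟩
    · have h0 : ‖α a x‖ < η := by
        have : α a x = 0 := ha
        rwa [this, norm_zero]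
      filter_upwards [((α a).continuous.norm.tendsto x).eventually (gt_mem_nhds h0)] with y hy
      have h1 : ‖α a y‖ / η ≤ 1 := (div_le_one hη0).2 hy.le
      rw [hk, ContinuousMap.coe_mk, min_eq_left (by linarith), max_eq_right zero_le_one,
        Complex.ofReal_one]
    · rw [hky]
      exact max_le zero_le_one (min_le_left _ _)
    · have hka : ‖k * α a‖ ≤ 2 * η := by
        refine (ContinuousMap.norm_le _ (by positivity)).2 fun y => ?_
        rw [ContinuousMap.mul_apply, norm_mul, hky]
        rcases le_total (‖α a y‖) (2 * η) with h | h
        · exact (mul_le_of_le_one_left (norm_nonneg _)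
            (max_le zero_le_one (min_le_left _ _))).trans h
        · have h1 : 2 ≤ ‖α a y‖ / η := (le_div_iff₀ hη0).2 h
          rw [max_eq_left ((min_le_right _ _).trans (by linarith)), zero_mul]
          positivity
      rw [hφ, ← mul_assoc, ← map_mul]
      refine (norm_mul_le _ _).trans_lt ?_
      have h2 : ‖ι (k * α a)‖ ≤ ε / (2 * (‖b‖ + 1)) :=
        (NonUnitalStarAlgHom.norm_apply_le ι _).trans (hka.trans_eq (by rw [hη]; ring))
      refine (mul_le_mul_of_nonneg_right h2 (norm_nonneg b)).trans_lt ?_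
      rw [div_mul_eq_mul_div, div_lt_iff₀ (by positivity)]
      nlinarith [norm_nonneg b]
  | zero =>
    intro ε hε
    exact ⟨1, Eventually.of_forall fun _ => rfl, hone, by simpa using hε⟩
  | add d e _ _ hd he =>
    intro ε hε
    obtain ⟨k, hk1, hk2, hk3⟩ := hd _ (half_pos hε)
    obtain ⟨l, hl1, hl2, hl3⟩ := he _ (half_pos hε)
    refine ⟨k * l, ?_, (norm_mul_le _ _).trans (mul_le_one₀ hk2 (norm_nonneg _) hl2), ?_⟩
    · filter_upwards [hk1, hl1] with y h1 h2
      rw [ContinuousMap.mul_apply, h1, h2, one_mul]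
    · have h1 : ι (k * l) * (d + e) = ι l * (ι k * d) + ι k * (ι l * e) := by
        rw [mul_add, ← mul_assoc, ← mul_assoc, ← map_mul, ← map_mul, mul_comm l k]
      rw [h1]
      linarith [norm_add_le (ι l * (ι k * d)) (ι k * (ι l * e)), hmul l (ι k * d) hl2,
        hmul k (ι l * e) hk2]
  | smul z d _ hd =>
    intro ε hε
    obtain ⟨k, hk1, hk2, hk3⟩ := hd (ε / (‖z‖ + 1)) (by positivity)
    refine ⟨k, hk1, hk2, ?_⟩
    rw [mul_smul_comm, norm_smul]
    rw [lt_div_iff₀ (by positivity)] at hk3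
    nlinarith [norm_nonneg (ι k * d)]

theorem norm_le_of_forall_norm_jetValue_lt [T2Space K] (hι : ∀ f, ι f ∈ Set.center B)
    (hφ : ∀ a, φ a = ι (α a)) {b : B} {r : ℝ} (hr : 0 ≤ r)
    (hb : ∀ x, ‖jetValue φ hc b (pointCharacter α hα x)‖ < r) : ‖b‖ ≤ r := by
  have hloc : ∀ x : K, ∃ (V : Set K) (g : B), V ∈ 𝓝 x ∧ ‖g‖ ≤ r ∧
      ∀ f : C(K, ℂ), (∀ y, f y ≠ 0 → y ∈ V) → ι f * g = ι f * b := by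
    intro x
    have hx := hb x
    rw [← valueSeminorm_normSeminorm_eq_norm] at hx
    obtain ⟨c, hcb, hcr⟩ := exists_lift_lt _ hx
    have hcr : ‖c‖ < r := hcr
    have hmem : b - c ∈ closure (kerMul φ (pointCharacter α hα x) : Set B) :=
      Ideal.Quotient.eq.1 hcb.symm
    have hδ : 0 < (r - ‖c‖) / 2 := by linarith
    obtain ⟨d, hd, hdist⟩ := Metric.mem_closure_iff.1 hmem _ hδ
    rw [dist_eq_norm] at hdist
    obtain ⟨k, hk1, -, hk3⟩ := exists_cutoff (hα := hα) hφ hd _ hδ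
    -- The local substitute is `b` with `d` replaced by its cutoff: nothing changes where `k = 1`,
    -- and the norm is at most `‖c‖` plus two errors `(r - ‖c‖) / 2`.
    refine ⟨{y | k y = 1}, c + (b - c - d) + ι k * d, hk1, ?_, fun f hf => ?_⟩
    · linarith [norm_add₃_le (a := c) (b := b - c - d) (c := ι k * d)]
    · have hfk : f * k = f := by
        ext y
        rw [ContinuousMap.mul_apply]
        by_cases h : f y = 0
        · rw [h, zero_mul]
        · rw [show k y = 1 from hf y h, mul_one]
      have h1 : ι f * (ι k * d) = ι f * d := by rw [← mul_assoc, ← map_mul, hfk]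
      rw [mul_add, h1, ← mul_add]
      congr 1
      abel
  choose V g hV hg hfg using hloc
  obtain ⟨s, h, hsum, hsupp⟩ := exists_finite_star_mul_self_partition V hV
  have hsum' : ∑ i ∈ s, star (ι (h i)) * ι (h i) = 1 := by
    rw [← map_one ι, ← hsum, map_sum]
    simp only [map_mul, map_star]
  have key := norm_sum_star_mul_self_mul_le s (fun i => ι (h i)) g (fun i => hι _) hsum' hr hg
  have heq : ∑ i ∈ s, star (ι (h i)) * ι (h i) * g i = b := by
    have h1 : ∀ i, star (ι (h i)) * ι (h i) * g i = star (ι (h i)) * ι (h i) * b := fun i => by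
      rw [mul_assoc, hfg i _ (hsupp i), ← mul_assoc]
    simp only [h1, ← Finset.sum_mul, hsum', one_mul]
  rwa [heq] at key

/-- In the fibre over a point of `K` the glued element is a convex combination of local
approximants, and only those within `ε` of the section there have nonzero weight. -/
theorem exists_forall_norm_sub_jetValue_le [T2Space K] [IsUniformAddGroup A] (hα : Continuous α)
    (hd : DenseRange α) (hφ : ∀ a, φ a = ι (α a))
    {x : ∀ t : InvolutiveSpectrum A, ValueFiber φ hc t} (hx : IsContinuousSection φ hc x)
    {ε : ℝ} (hε : 0 < ε) : ∃ b : B, ∀ t, ‖x t - jetValue φ hc b t‖ ≤ ε := by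
  have hloc : ∀ y : K, ∃ b : B, ∀ᶠ z in 𝓝 y, ‖x (pointCharacter α hα z) -
      jetValue φ hc b (pointCharacter α hα z)‖ < ε := by
    intro y
    obtain ⟨b, hb⟩ := isContinuousSection_iff.1 hx (pointCharacter α hα y) ε hε
    simp only [valueSeminorm_normSeminorm_eq_norm] at hb
    exact ⟨b, ((continuous_pointCharacter α hα).tendsto y).eventually hb⟩
  choose b hb using hloc
  obtain ⟨s, h, hsum, hsupp⟩ := exists_finite_star_mul_self_partition _ hb
  refine ⟨∑ i ∈ s, ι (star (h i) * h i) * b i, fun t => ?_⟩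
  by_cases ht : t ∈ Set.range (pointCharacter α hα)
  swap
  · obtain ⟨c, hcx⟩ := Ideal.Quotient.mk_surjective (x t)
    have hcx : jetValue φ hc c t = x t := hcx
    rw [← hcx, jetValue_eq_zero_of_notMem_range hφ ht, jetValue_eq_zero_of_notMem_range hφ ht,
      sub_zero, norm_zero]
    exact hε.le
  obtain ⟨z, rfl⟩ := ht
  set t := pointCharacter α hα z
  have hone : ∑ i ∈ s, (star (h i) * h i) z = 1 := by
    rw [← ContinuousMap.sum_apply, hsum, ContinuousMap.one_apply]
  have hjet : jetValue φ hc (∑ i ∈ s, ι (star (h i) * h i) * b i) t =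
      ∑ i ∈ s, (star (h i) * h i) z • jetValue φ hc (b i) t :=
    (map_sum (Ideal.Quotient.mk (valueIdeal φ hc t)) _ s).trans
      (Finset.sum_congr rfl fun i _ => jetValue_map_mul hd hφ _ (b i) z)
  have hsub : x t - jetValue φ hc (∑ i ∈ s, ι (star (h i) * h i) * b i) t =
      ∑ i ∈ s, (star (h i) * h i) z • (x t - jetValue φ hc (b i) t) := by
    simp only [smul_sub, Finset.sum_sub_distrib, ← Finset.sum_smul, hone, one_smul, hjet]
  have hnorm : ∀ i, ‖(star (h i) * h i) z‖ = ((star (h i) * h i) z).re := by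
    intro i
    rw [ContinuousMap.mul_apply, ContinuousMap.star_apply, Complex.star_def,
      ← Complex.normSq_eq_conj_mul_self, Complex.ofReal_re, Complex.norm_real,
      Real.norm_of_nonneg (Complex.normSq_nonneg _)]
  rw [hsub]
  calc _ ≤ ∑ i ∈ s, ((star (h i) * h i) z).re * ε := by
        refine (norm_sum_le _ _).trans (Finset.sum_le_sum fun i _ => ?_)
        rw [norm_smul, hnorm]
        by_cases h0 : h i z = 0
        · simp [h0]
        · rw [← hnorm]
          exact mul_le_mul_of_nonneg_left (hsupp i z h0).le (norm_nonneg _)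
    _ = ε := by rw [← Finset.sum_mul, ← Complex.re_sum, hone, Complex.one_re, one_mul]

end FactorThroughContinuousFunctions

/-! ### The map `j⁰` and the Gelfand factorization. -/

section Isomorphism

variable {A : Type*} [CommRing A] [Algebra ℂ A] [StarRing A] [UniformSpace A]
  {B : Type*} [CStarAlgebra B]

/-- The homomorphism `b ↦ j⁰(b)` from `B` to the continuous sections of the value bundle. -/
noncomputable def jetSection (φ : A →⋆ₐ[ℂ] B) (hc : ∀ a, φ a ∈ Set.center B) :
    B →⋆ₐ[ℂ] continuousSections φ hc where
  toFun b := ⟨jetValue φ hc b, isContinuousSection_jetValue b⟩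
  map_one' := rfl
  map_mul' _ _ := rfl
  map_zero' := rfl
  map_add' _ _ := rfl
  commutes' _ := rfl
  map_star' _ := rfl

theorem norm_jetValue_le {φ : A →⋆ₐ[ℂ] B} {hc : ∀ a, φ a ∈ Set.center B} (b : B)
    (t : InvolutiveSpectrum A) : ‖jetValue φ hc b t‖ ≤ ‖b‖ :=
  Submodule.Quotient.norm_mk_le _ b

/-- A continuous `⋆`-homomorphism with central range factors through the algebra of continuous
functions on a compact Hausdorff space, via the Gelfand transform of the closure of its range. -/
theorem exists_factor_through_continuousMap.{u} {B : Type u} [CStarAlgebra B] (φ : A →⋆ₐ[ℂ] B) (hφ : Continuous φ)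
    (hc : ∀ a, φ a ∈ Set.center B) :
    ∃ (K : Type u) (_ : TopologicalSpace K) (_ : CompactSpace K) (_ : T2Space K)
      (ι : C(K, ℂ) →⋆ₐ[ℂ] B) (α : A →⋆ₐ[ℂ] C(K, ℂ)), Continuous α ∧ DenseRange α ∧
        (∀ f, ι f ∈ Set.center B) ∧ ∀ a, φ a = ι (α a) := by
  set C := φ.range.topologicalClosure with hC
  have hcen : ∀ c ∈ C, c ∈ Set.center B := by
    intro c hcC
    refine closure_minimal ?_ ?_ hcC
    -- The centre is a centralizer, hence closed, so it contains the closure of the range.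
    · rintro _ ⟨a, rfl⟩
      exact hc a
    · rw [← Set.centralizer_univ]
      exact Set.isClosed_centralizer _
  have hclosed : IsClosed (C : Set B) := StarSubalgebra.isClosed_topologicalClosure _
  let _ : CommCStarAlgebra C :=
    { StarSubalgebra.cstarAlgebra C with
      mul_comm := fun c d => Subtype.ext ((hcen c c.2).comm d) }
  let G : C ≃⋆ₐ[ℂ] C(WeakDual.characterSpace ℂ C, ℂ) := gelfandStarTransform C
  have hG : Continuous G := AddMonoidHomClass.continuous_of_bound G 1 fun f => by
    rw [one_mul]; exact NonUnitalStarAlgHom.norm_apply_le G f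
  have hmem : ∀ a, φ a ∈ C := fun a => subset_closure ⟨a, rfl⟩
  let ψ : A →⋆ₐ[ℂ] C := StarAlgHom.codRestrict φ C hmem
  have hψ : Continuous ψ := hφ.subtype_mk hmem
  have hψd : DenseRange ψ := by
    intro c
    rw [closure_subtype]
    have : ((↑) : C → B) '' Set.range ψ = (φ.range : Set B) := by
      rw [← Set.range_comp]; rfl
    rw [this]
    exact c.2
  refine ⟨WeakDual.characterSpace ℂ C, inferInstance, inferInstance, inferInstance,
    C.subtype.comp (G.symm : C(WeakDual.characterSpace ℂ C, ℂ) →⋆ₐ[ℂ] C),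
    (G : C →⋆ₐ[ℂ] C(WeakDual.characterSpace ℂ C, ℂ)).comp ψ, hG.comp hψ,
    G.surjective.denseRange.comp hψd hG, fun f => hcen _ (G.symm f).2, fun a => ?_⟩
  exact (congrArg Subtype.val (G.symm_apply_apply (ψ a))).symm

end Isomorphism

/-! ### Assembly of the isometric isomorphism and comparison of topologies. -/

theorem mainTheorem5 {A : Type*} [CommRing A] [Algebra ℂ A] [StarRing A] [StarModule ℂ A]
    [UniformSpace A] [InvolutiveStereotypeAlgebra A] {B : Type*} [CStarAlgebra B]
    (φ : A →⋆ₐ[ℂ] B) (hφ : Continuous φ) (hc : ∀ a, φ a ∈ Set.center B) :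
    (∀ x : continuousSections φ hc, BddAbove (Set.range (sectionNormAt φ hc x))) ∧
    ∃ v : B ≃⋆ₐ[ℂ] continuousSections φ hc,
      (∀ b t, (v b).1 t = jetValue φ hc b t) ∧
      (∀ b, sectionNorm φ hc (v b) = ‖b‖) ∧
      @IsHomeomorph B (continuousSections φ hc) _ (sectionTopology φ hc) v := by
  obtain ⟨K, _, _, _, ι, α, hα, hd, hι, hfac⟩ := exists_factor_through_continuousMap φ hφ hc
  have hT : IsCompact (Set.range (pointCharacter α hα)) :=
    isCompact_range (continuous_pointCharacter α hα)
  have hsub : ∀ (b c : B) (t : InvolutiveSpectrum A),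
      jetValue φ hc (b - c) t = jetValue φ hc b t - jetValue φ hc c t := fun b c t =>
    map_sub (Ideal.Quotient.mk (valueIdeal φ hc t)) b c
  -- The fibres over the compact image of `K` detect the norm. If `Spec(A)` is empty, this forces `B
  -- = 0`, in agreement with `sup ∅ = 0`.
  have hlower : ∀ (b : B) (r : ℝ), 0 ≤ r →
      (∀ t ∈ Set.range (pointCharacter α hα), ‖jetValue φ hc b t‖ ≤ r) → ‖b‖ ≤ r :=
    fun b r hr hb => le_of_forall_pos_le_add fun ε hε =>
      norm_le_of_forall_norm_jetValue_lt (hα := hα) hι hfac (by linarith)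
        fun x => (hb _ ⟨x, rfl⟩).trans_lt (lt_add_of_pos_right r hε)
  have hinj : Function.Injective (jetSection φ hc) := by
    refine (injective_iff_map_eq_zero _).2 fun b hb => norm_le_zero_iff.1
      (hlower b 0 le_rfl fun t _ => ?_)
    have : jetValue φ hc b t = 0 := congrFun (congrArg Subtype.val hb) t
    rw [this, norm_zero]
  have hsurj : Function.Surjective (jetSection φ hc) := by
    intro x
    choose b hb using fun n : ℕ => exists_forall_norm_sub_jetValue_le hα hd hfac x.2
      (Nat.one_div_pos_of_nat (α := ℝ) (n := n))
    have hlim := tendsto_one_div_add_atTop_nhds_zero_nat (𝕜 := ℝ)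
    have hcau : CauchySeq b := by
      refine cauchySeq_of_le_tendsto_0' (fun n : ℕ => 2 * (1 / ((n : ℝ) + 1))) (fun n m hnm => ?_)
        (by simpa using hlim.const_mul 2)
      have hmn : 1 / ((m : ℝ) + 1) ≤ 1 / ((n : ℝ) + 1) := Nat.one_div_le_one_div hnm
      rw [dist_eq_norm]
      -- Both approximants are fibrewise close to the same section, so the norm estimate makes them
      -- close in `B`.
      refine hlower _ _ (by positivity) fun t _ => ?_
      have e : jetValue φ hc (b n - b m) t =
          (x.1 t - jetValue φ hc (b m) t) - (x.1 t - jetValue φ hc (b n) t) := by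
        rw [hsub]; abel
      rw [e]
      linarith [norm_sub_le (x.1 t - jetValue φ hc (b m) t) (x.1 t - jetValue φ hc (b n) t),
        hb n t, hb m t]
    obtain ⟨c, hcl⟩ := cauchySeq_tendsto_of_complete hcau
    refine ⟨c, Subtype.ext (funext fun t => ?_)⟩
    change jetValue φ hc c t = x.1 t
    rw [eq_comm, ← sub_eq_zero, ← norm_le_zero_iff]
    have hlim2 : Tendsto (fun n : ℕ => 1 / ((n : ℝ) + 1) + ‖b n - c‖) atTop (𝓝 0) := by
      simpa using hlim.add (tendsto_iff_norm_sub_tendsto_zero.1 hcl)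
    refine ge_of_tendsto' hlim2 fun n => ?_
    have e : x.1 t - jetValue φ hc c t =
        (x.1 t - jetValue φ hc (b n) t) + jetValue φ hc (b n - c) t := by
      rw [hsub]; abel
    rw [e]
    exact (norm_add_le _ _).trans (add_le_add (hb n t) (norm_jetValue_le _ t))
  have hbdd : ∀ b, ‖b‖ ∈ upperBounds (Set.range (sectionNormAt φ hc (jetSection φ hc b))) := by
    rintro b _ ⟨t, rfl⟩
    exact (valueSeminorm_normSeminorm_eq_norm _).trans_le (norm_jetValue_le b t)
  refine ⟨fun x => ?_, StarAlgEquiv.ofBijective (jetSection φ hc) ⟨hinj, hsurj⟩,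
    fun b t => rfl, fun b => ?_, ?_⟩
  · obtain ⟨b, rfl⟩ := hsurj x
    exact ⟨‖b‖, hbdd b⟩
  · change ⨆ t, sectionNormAt φ hc (jetSection φ hc b) t = ‖b‖
    refine le_antisymm (Real.iSup_le (fun t => hbdd b ⟨t, rfl⟩) (norm_nonneg b))
      (hlower b _ (Real.iSup_nonneg fun t => valueSeminorm_nonneg _ _) fun t _ => ?_)
    rw [← valueSeminorm_normSeminorm_eq_norm]
    exact le_ciSup (f := sectionNormAt φ hc (jetSection φ hc b)) ⟨‖b‖, hbdd b⟩ t
  · let _ := sectionTopology φ hc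
    change IsHomeomorph (jetSection φ hc)
    refine ⟨continuous_generateFrom_iff.2 ?_, ?_, hinj, hsurj⟩
    · rintro _ ⟨x, T, p, ε, hTc, hp, hε, rfl⟩
      obtain ⟨c, rfl⟩ := hsurj x
      refine isOpen_iff_mem_nhds.2 fun b hb => ?_
      have hb : ∀ t ∈ T, valueSeminorm φ hc p (jetValue φ hc (b - c) t) < ε := fun t ht => by
        rw [hsub]; exact hb t ht
      -- Upper semicontinuity and compactness turn the pointwise strict bound into a uniform one,
      -- leaving a margin `ε - r` for moving `b`. The value `ε - 1` serves only the empty set.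
      obtain ⟨r, hr, hbr⟩ : ∃ r < ε, ∀ t ∈ T,
          valueSeminorm φ hc p (jetValue φ hc (b - c) t) < r := by
        refine hTc.induction_on (p := fun S => ∃ r < ε, ∀ t ∈ S,
          valueSeminorm φ hc p (jetValue φ hc (b - c) t) < r) ⟨ε - 1, by linarith, by simp⟩
          (fun S S' hSS' ⟨r, hr, h⟩ => ⟨r, hr, fun t ht => h t (hSS' ht)⟩) ?_ fun t ht => ?_
        · rintro S S' ⟨r, hr, h⟩ ⟨r', hr', h'⟩
          refine ⟨max r r', max_lt hr hr', ?_⟩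
          rintro t (ht | ht)
          · exact (h t ht).trans_le (le_max_left _ _)
          · exact (h' t ht).trans_le (le_max_right _ _)
        · obtain ⟨r, hr1, hr2⟩ := exists_between (hb t ht)
          exact ⟨_, mem_nhdsWithin_of_mem_nhds (eventually_valueSeminorm_lt hp hr1), r, hr2,
            fun s hs => hs⟩
      have hnhds : ∀ᶠ b' in 𝓝 b, p (b' - b) < ε - r := by
        have hcont : Continuous fun b' => p (b' - b) := hp.comp (by fun_prop)
        refine (hcont.tendsto b).eventually (gt_mem_nhds ?_)
        rw [sub_self, map_zero]
        linarith
      filter_upwards [hnhds] with b' hb' t ht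
      have e : jetValue φ hc b' t - jetValue φ hc c t =
          jetValue φ hc (b' - b) t + jetValue φ hc (b - c) t := by
        rw [hsub, hsub]; abel
      change valueSeminorm φ hc p (jetValue φ hc b' t - jetValue φ hc c t) < ε
      rw [e]
      linarith [valueSeminorm_add_le p (jetValue φ hc (b' - b) t) (jetValue φ hc (b - c) t),
        valueSeminorm_mk_le (φ := φ) (hc := hc) (t := t) p (b' - b), hbr t ht]
    · intro U hU
      refine isOpen_iff_mem_nhds.2 ?_
      rintro _ ⟨b, hb, rfl⟩
      obtain ⟨ε, hε, hball⟩ := Metric.isOpen_iff.1 hU b hb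
      -- One basic open set, over the compact image of `K`, already fits inside the image of a norm
      -- ball; `ε / 2` restores the strict inequality, since `hlower` gives only `≤`.
      have hopen : IsOpen {y : continuousSections φ hc | ∀ t ∈ Set.range (pointCharacter α hα),
          valueSeminorm φ hc (normSeminorm ℂ B) (y.1 t - (jetSection φ hc b).1 t) < ε / 2} :=
        TopologicalSpace.isOpen_generateFrom_of_mem
          ⟨_, _, normSeminorm ℂ B, ε / 2, hT, continuous_norm, half_pos hε, rfl⟩
      refine mem_of_superset (hopen.mem_nhds fun t _ => ?_) fun y hy => ?_
      · rw [sub_self, valueSeminorm_normSeminorm_eq_norm, norm_zero]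
        exact half_pos hε
      · obtain ⟨c, rfl⟩ := hsurj y
        refine ⟨c, hball ?_, rfl⟩
        rw [Metric.mem_ball, dist_eq_norm]
        refine (hlower _ (ε / 2) (half_pos hε).le fun t ht => ?_).trans_lt (half_lt_self hε)
        rw [hsub, ← valueSeminorm_normSeminorm_eq_norm]
        exact (hy t ht).le
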